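/- Let $k$ be a field of characteristic $0$. By a normal integral variety over $k$ we mean a normal integral scheme that is separated and of finite type over $k$. A cover is a finite surjective morphism of normal integral varieties over $k$; it is ramified if it is not unramified, and Galois if the induced extension of function fields is Galois. A subset $\Sigma \subseteq X(k)$, where $X$ is a normal integral variety over $k$, is very thin in $X$ if there are an integer $n \geq 0$ and ramified covers $\pi_i \colon Y_i \to X$ ($i = 1, \dots, n$) such that $\Sigma \setminus \bigcup_{i=1}^n \pi_i(Y_i(k))$ is not dense in $X$. Proposition. Let $X$ be a normal integral variety over a field $k$ of characteristic $0$, and let $\Sigma \subseteq X(k)$ be a subset. Let $Z \to X$ be a Galois ramified cover with no nontrivial étale subcovers; that is, whenever $Z \to X$ factors as a composition of covers $Z \to Y \to X$ with $Y \to X$ étale, the morphism $Y \to X$ is an isomorphism. If $\Sigma$ is not very thin in $X$, then there is a subset $T \subseteq \Sigma$ that is dense in $X$ such that for every $x \in T$ the scheme-theoretic fibre $Z_x = Z \times_X \operatorname{Spec} k$ is integral. -/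

import Mathlib

open CategoryTheory CategoryTheory.Limits

universe u

namespace AlgebraicGeometry.VeryThin

/-- `s : X ⟶ Spec k` makes `X` a normal integral variety over the field `k`: an integral scheme,
separated and of finite type over `k`, all of whose local rings are integrally closed. -/
class IsNormalVariety {k : Type u} [Field k] {X : Scheme.{u}} (s : X ⟶ Spec (.of k)) : Prop where
  isIntegral : IsIntegral X
  isSeparated : IsSeparated s
  locallyOfFiniteType : LocallyOfFiniteType s
  quasiCompact : QuasiCompact s
  isIntegrallyClosed_stalk : ∀ x : X, IsIntegrallyClosed (X.presheaf.stalk x)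

/-- The set `X(k)` of `k`-rational points of the `k`-scheme `s : X ⟶ Spec k`. -/
def RationalPoint {k : Type u} [Field k] {X : Scheme.{u}} (s : X ⟶ Spec (.of k)) : Type u :=
  {x : Spec (.of k) ⟶ X // x ≫ s = 𝟙 (Spec (.of k))}

namespace RationalPoint

variable {k : Type u} [Field k] {X Y : Scheme.{u}}

/-- The point of the topological space of `X` underlying a rational point. -/
noncomputable def pt {s : X ⟶ Spec (.of k)} (x : RationalPoint s) : X :=
  x.1 (IsLocalRing.closedPoint k)

/-- The map `Y(k) → X(k)` induced by `π : Y ⟶ X`, where `Y` is a `k`-scheme via `π`. -/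
noncomputable def map (s : X ⟶ Spec (.of k)) (π : Y ⟶ X) (y : RationalPoint (π ≫ s)) : RationalPoint s :=
  ⟨y.1 ≫ π, by rw [Category.assoc]; exact y.2⟩

/-- The scheme-theoretic fibre `Y_x = Y ×_X Spec k` of `π : Y ⟶ X` over a rational point `x`. -/
noncomputable def fibre {s : X ⟶ Spec (.of k)} (π : Y ⟶ X) (x : RationalPoint s) : Scheme.{u} :=
  pullback π x.1

end RationalPoint

section Covers

variable {k : Type u} [Field k] {X Y : Scheme.{u}}

/-- `π : Y ⟶ X` is a cover of the `k`-scheme `s : X ⟶ Spec k`: a finite surjective morphism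
between normal integral varieties over `k`. -/
class IsCover (s : X ⟶ Spec (.of k)) (π : Y ⟶ X) : Prop where
  target : IsNormalVariety s
  source : IsNormalVariety (π ≫ s)
  isFinite : IsFinite π
  surjective : Surjective π

/-- A ramified cover: a cover which is not unramified. (A finite morphism is of finite type, so
it is unramified if and only if it is formally unramified.) -/
class IsRamifiedCover (s : X ⟶ Spec (.of k)) (π : Y ⟶ X) : Prop extends IsCover s π where
  not_unramified : ¬ FormallyUnramified π

theorem specializes_genericPoint (π : Y ⟶ X) [IrreducibleSpace X] [IrreducibleSpace Y]
    [IsDominant π] : π (genericPoint Y) ⤳ genericPoint X := by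
  have h := (genericPoint_spec Y).image π.continuous
  rw [specializes_iff_mem_closure, h.def, Set.image_univ, π.denseRange.closure_range]
  trivial

/-- The homomorphism `K(X) → K(Y)` of function fields induced by a dominant morphism `Y ⟶ X` of
irreducible schemes. -/
noncomputable def functionFieldMap (π : Y ⟶ X) [IrreducibleSpace X] [IrreducibleSpace Y]
    [IsDominant π] : X.functionField ⟶ Y.functionField :=
  X.presheaf.stalkSpecializes (specializes_genericPoint π) ≫ π.stalkMap (genericPoint Y)

/-- The function field extension `K(Y) / K(X)` of a dominant morphism of integral schemes is a
Galois extension. -/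
def IsFunctionFieldGalois (π : Y ⟶ X) [IsIntegral X] [IsIntegral Y] [IsDominant π] : Prop :=
  letI : Algebra X.functionField Y.functionField := (functionFieldMap π).hom.toAlgebra
  IsGalois X.functionField Y.functionField

/-- A Galois cover: a cover whose extension of function fields is Galois. -/
class IsGaloisCover (s : X ⟶ Spec (.of k)) (π : Y ⟶ X) : Prop extends IsCover s π where
  isGalois :
    haveI : IsIntegral X := target.isIntegral
    haveI : IsIntegral Y := source.isIntegral
    haveI : Surjective π := surjective
    IsFunctionFieldGalois π

/-- `π : Z ⟶ X` has no nontrivial étale subcovers: whenever `π` factors into covers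
`Z ⟶ Y ⟶ X` with `Y ⟶ X` étale, the cover `Y ⟶ X` is an isomorphism. -/
def HasNoNontrivialEtaleSubcovers {Z : Scheme.{u}} (s : X ⟶ Spec (.of k)) (π : Z ⟶ X) : Prop :=
  ∀ (Y : Scheme.{u}) (f : Z ⟶ Y) (g : Y ⟶ X), f ≫ g = π →
    IsCover (g ≫ s) f → IsCover s g → Etale g → IsIso g

/-- `T ⊆ X(k)` is very thin in `X`: there are finitely many ramified covers `π i : Y i ⟶ X` such
that `T \ ⋃ i, π i (Y i (k))` is not dense in `X`. -/
def IsVeryThin (s : X ⟶ Spec (.of k)) (T : Set (RationalPoint s)) : Prop :=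
  ∃ (n : ℕ) (Y : Fin n → Scheme.{u}) (π : ∀ i, Y i ⟶ X),
    (∀ i, IsRamifiedCover s (π i)) ∧
      ¬ Dense (RationalPoint.pt '' (T \ ⋃ i, Set.range (RationalPoint.map s (π i))))

end Covers

end AlgebraicGeometry.VeryThin

open AlgebraicGeometry AlgebraicGeometry.VeryThin

/-!
Let `G` be the Galois group of `K(Z) / K(X)`. For a subgroup `H` of `G`, let `Y_H` be the
normalization of `X` in the fixed field of `H`, so that `Z ⟶ X` factors into covers
`Z ⟶ Y_H ⟶ X` (`exists_intermediate_cover`). If `H` is a proper subgroup, then `Y_H ⟶ X` is not an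
isomorphism (`fixedField_eq_bot_of_isIso`), hence not étale by hypothesis. In characteristic zero an
unramified cover of normal varieties is étale (`IsCover.etale_of_formallyUnramified`), so
`Y_H ⟶ X` is ramified. As `S` is not very thin, the set of points of `S` which lift to no `Y_H(k)`
with `H ≠ G` is dense.

Let `x` be such a point. If two points of `Z` lie above `x`, let `H` be the decomposition group of
one of them, say `z`. It is a proper subgroup because `G` acts transitively on the fibre, and the
image of `z` in `Y_H` has residue field `k`, because `H` maps onto the automorphism group of the
Galois extension `κ(z) / k`. So `x` lifts to `Y_H(k)`
(`RationalPoint.exists_subgroup_mem_range_map`), a contradiction. Hence `Z_x` is a single point. It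
is reduced as soon as `x` lies in the dense open set over which `Z ⟶ X` is unramified
(`exists_isReduced_pullback`), and the set `T` of all such `x` is still dense.

Flatness of an unramified cover is proved by counting: locally on the base, the fibre algebra is
generated by one element, and the integral equation of a lift of this element bounds the dimension
of the fibre by the degree of the cover (`Algebra.FormallyUnramified.free_of_isLocalRing`).
-/

/-! ### Unramified extensions of integrally closed domains -/

open TensorProduct in
/-- A finite étale algebra over an infinite field has a generator. Generation is expressed by the
degree bound on annihilating polynomials, which is all that is needed below. The element `θ` is
chosen to separate the geometric points of `R`, whose number is the dimension of `R`; this is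
possible because a vector space over an infinite field is not a finite union of proper subspaces. -/
theorem Algebra.exists_finrank_le_natDegree_of_aeval_eq_zero {κ : Type u} [Field κ] [Infinite κ]
    {R : Type u} [CommRing R] [Algebra κ R] [Module.Finite κ R] [Algebra.FormallyUnramified κ R] :
    ∃ θ : R, ∀ F : Polynomial κ, Polynomial.aeval θ F = 0 → F ≠ 0 →
      Module.finrank κ R ≤ F.natDegree := by
  classical
  have : Algebra.FormallyEtale κ R := .of_formallyUnramified_of_field κ R
  let Ω := AlgebraicClosure κ
  let e := Algebra.FormallyEtale.equivPiOfIsSepClosed Ω (Ω ⊗[κ] R)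
  let P := PrimeSpectrum (Ω ⊗[κ] R)
  have : IsArtinianRing (Ω ⊗[κ] R) := .of_finite Ω _
  have : Finite P := inferInstanceAs (Finite (PrimeSpectrum _))
  have := Fintype.ofFinite P
  have hcard : Module.finrank κ R = Fintype.card P := by
    rw [← Module.finrank_baseChange (R := Ω) (S := κ), e.toLinearEquiv.finrank_eq]
    exact Module.finrank_fintype_fun_eq_card Ω
  let φ (p : P) : R →ₐ[κ] Ω :=
    (((Pi.evalAlgHom Ω (fun _ : P ↦ Ω) p).comp e.toAlgHom).restrictScalars κ).comp
      Algebra.TensorProduct.includeRight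
  have hφ (p q : P) (hpq : φ p = φ q) : p = q := by
    have h : (Pi.evalAlgHom Ω (fun _ : P ↦ Ω) p).comp e.toAlgHom =
        (Pi.evalAlgHom Ω (fun _ : P ↦ Ω) q).comp e.toAlgHom :=
      Algebra.TensorProduct.ext (Subsingleton.elim _ _) hpq
    by_contra hne
    have h' := DFunLike.congr_fun h (e.symm (Pi.single p 1))
    simp [Ne.symm hne] at h'
  let s : Finset (Subspace κ R) :=
    (Finset.univ.filter fun x : P × P ↦ x.1 ≠ x.2).image
      fun x ↦ LinearMap.eqLocus (φ x.1).toLinearMap (φ x.2).toLinearMap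
  have hs : ⊤ ∉ s := by
    simp only [s, Finset.mem_image, Finset.mem_filter, Finset.mem_univ, true_and, not_exists,
      not_and]
    intro x hx htop
    refine hx (hφ _ _ (AlgHom.ext fun r ↦ ?_))
    exact (htop ▸ Submodule.mem_top : r ∈ LinearMap.eqLocus (φ x.1).toLinearMap (φ x.2).toLinearMap)
  obtain ⟨θ, hθ⟩ := (Set.ne_univ_iff_exists_notMem _).mp (Subspace.biUnion_ne_univ_of_top_notMem hs)
  refine ⟨θ, fun F hF hF0 ↦ ?_⟩
  have hinj : Function.Injective fun p ↦ φ p θ := by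
    intro p q hpq
    by_contra hne
    refine hθ (Set.mem_iUnion₂.mpr ⟨_, Finset.mem_image.mpr ⟨(p, q), by simpa using hne, rfl⟩, ?_⟩)
    exact hpq
  rw [hcard, ← Finset.card_univ, ← Finset.card_image_of_injective _ hinj]
  refine le_trans (Finset.card_le_card ?_)
    ((Multiset.toFinset_card_le _).trans ((F.map (algebraMap κ Ω)).card_roots'.trans
      F.natDegree_map_le))
  intro y hy
  obtain ⟨p, -, rfl⟩ := Finset.mem_image.mp hy
  rw [Multiset.mem_toFinset, Polynomial.mem_roots
    ((Polynomial.map_ne_zero_iff (algebraMap κ Ω).injective).mpr hF0), Polynomial.IsRoot,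
    Polynomial.eval_map_algebraMap, Polynomial.aeval_algHom_apply, hF, map_zero]

open TensorProduct in
/-- A finite unramified extension of domains is free over a local integrally closed base with
infinite residue field `κ`. Lifting a generator of `κ ⊗ C` to `c : C`, the minimal polynomial of
`c` over `Frac A` has coefficients in `A`, whence `dim (κ ⊗ C) ≤ [Frac C : Frac A]`. By Nakayama's
lemma `C` is then generated by at most as many elements as its rank, so they form a basis. -/
theorem Algebra.FormallyUnramified.free_of_isLocalRing {A C : Type u} [CommRing A] [CommRing C]
    [IsDomain A] [IsDomain C] [IsLocalRing A] [IsIntegrallyClosed A]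
    [Algebra A C] [FaithfulSMul A C] [Module.Finite A C] [Algebra.FormallyUnramified A C]
    [Infinite (IsLocalRing.ResidueField A)] : Module.Free A C := by
  classical
  let κ := IsLocalRing.ResidueField A
  let K := FractionRing A
  let L := FractionRing C
  let _ : Algebra K L := FractionRing.liftAlgebra A L
  have : Module.IsTorsionFree A C := inferInstance
  have : IsScalarTower A K L := inferInstance
  have : IsLocalization (Algebra.algebraMapSubmonoid C (nonZeroDivisors A)) L :=
    inferInstance
  have : Module.Finite K L := Module.Finite.of_isLocalization A C (nonZeroDivisors A)
  have hsurj : Function.Surjective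
      (Algebra.TensorProduct.includeRight : C →ₐ[A] κ ⊗[A] C) :=
    Algebra.TensorProduct.includeRight_surjective C IsLocalRing.residue_surjective
  obtain ⟨θ, hθ⟩ := Algebra.exists_finrank_le_natDegree_of_aeval_eq_zero (κ := κ) (R := κ ⊗[A] C)
  obtain ⟨c, rfl⟩ := hsurj θ
  have hc : IsIntegral A c := Algebra.IsIntegral.isIntegral c
  have hle : Module.finrank κ (κ ⊗[A] C) ≤ Module.finrank K L := by
    have hmonic := minpoly.monic hc
    refine (hθ ((minpoly A c).map (algebraMap A κ)) ?_ (hmonic.map _).ne_zero).trans ?_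
    · rw [Polynomial.aeval_map_algebraMap, Polynomial.aeval_algHom_apply, minpoly.aeval, map_zero]
    · have hK : minpoly K (algebraMap C L c) = (minpoly A c).map (algebraMap A K) := by
        rw [minpoly.isIntegrallyClosed_eq_field_fractions K L hc]
      rw [hmonic.natDegree_map, ← hmonic.natDegree_map (algebraMap A K), ← hK]
      exact minpoly.natDegree_le _
  let b := Module.finBasis κ (κ ⊗[A] C)
  choose v hv using fun i ↦ hsurj (b i)
  have hspan : Submodule.span A (Set.range v) = ⊤ :=
    IsLocalRing.span_eq_top_of_tmul_eq_basis v b hv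
  have hspanL := span_eq_top_localization_localization K (nonZeroDivisors A) L hspan
  rw [← Set.range_comp] at hspanL
  have hli := linearIndependent_of_top_le_span_of_card_le_finrank hspanL.ge (by simpa using hle)
  have hliA : LinearIndependent A v :=
    (hli.restrict_scalars' A).of_comp (IsScalarTower.toAlgHom A C L).toLinearMap
  exact Module.Free.of_basis (Module.Basis.mk hliA hspan.ge)

/-- The field `k` only serves to make all residue fields of `A` infinite. -/
theorem Algebra.FormallyUnramified.flat_of_isIntegrallyClosed (k : Type*) [Field k] [Infinite k]
    {A C : Type u} [CommRing A] [CommRing C] [Algebra k A]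
    [IsDomain A] [IsDomain C] [IsIntegrallyClosed A]
    [Algebra A C] [FaithfulSMul A C] [Module.Finite A C] [Algebra.FormallyUnramified A C] :
    Module.Flat A C := by
  refine Module.flat_of_isLocalized_maximal A C
    (fun P _ ↦ Localization (Algebra.algebraMapSubmonoid C P.primeCompl))
    (fun P _ ↦ (IsScalarTower.toAlgHom A C _).toLinearMap) fun P _ ↦ ?_
  let Ap := Localization.AtPrime P
  let Cp := Localization (Algebra.algebraMapSubmonoid C P.primeCompl)
  have hP : P.primeCompl ≤ nonZeroDivisors A := P.primeCompl_le_nonZeroDivisors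
  have hP' : Algebra.algebraMapSubmonoid C P.primeCompl ≤ nonZeroDivisors C :=
    algebraMapSubmonoid_le_nonZeroDivisors_of_faithfulSMul C hP
  have : IsDomain Cp := IsLocalization.isDomain_localization hP'
  have : IsIntegrallyClosed Ap := isIntegrallyClosed_of_isLocalization Ap P.primeCompl hP
  have : Module.Finite Ap Cp := Module.Finite.of_isLocalization A C P.primeCompl
  have : IsLocalization (P.primeCompl.map (algebraMap A C)) Cp :=
    inferInstanceAs (IsLocalization (Algebra.algebraMapSubmonoid C P.primeCompl) Cp)
  have : Algebra.FormallyUnramified Ap Cp :=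
    Algebra.FormallyUnramified.localization_map (R := A) (S := C) P.primeCompl
  have : FaithfulSMul Ap Cp := (faithfulSMul_iff_algebraMap_injective Ap Cp).mpr
    (localizationAlgebra_injective Ap Cp (FaithfulSMul.algebraMap_injective A C))
  have : Infinite (IsLocalRing.ResidueField Ap) :=
    Infinite.of_injective _ (algebraMap k (IsLocalRing.ResidueField Ap)).injective
  have := Algebra.FormallyUnramified.free_of_isLocalRing (A := Ap) (C := Cp)
  exact Module.Flat.trans A Ap Cp

/-! ### Decomposition groups -/

section Decomposition

open scoped Pointwise

/-- The prime of `B ^ H` below `Q`, for `H` the decomposition group of `Q`, has the same residue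
field as `P`: the group `H` maps onto the automorphism group of the Galois extension of residue
fields at `Q`. -/
theorem Ideal.exists_sub_algebraMap_mem_of_fixed {A B G : Type*} [CommRing A] [CommRing B]
    [Algebra A B] [Group G] [Finite G] [MulSemiringAction G B] [SMulCommClass G A B]
    [Algebra.IsInvariant A B G] [Module.Finite A B] (P : Ideal A) [P.IsMaximal] (Q : Ideal B)
    [Q.IsMaximal] [Q.LiesOver P] [CharZero (A ⧸ P)]
    {b : B} (hb : ∀ g ∈ MulAction.stabilizer G Q, g • b = b) :
    ∃ a : A, b - algebraMap A B a ∈ Q := by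
  let _ := Ideal.Quotient.field P
  let _ := Ideal.Quotient.field Q
  have := Ideal.Quotient.normal G P Q
  have : Module.Finite (A ⧸ P) (B ⧸ Q) := inferInstance
  have : IsGalois (A ⧸ P) (B ⧸ Q) := ⟨⟩
  have h : (Ideal.Quotient.mk Q b) ∈ (⊥ : IntermediateField (A ⧸ P) (B ⧸ Q)) := by
    rw [IsGalois.mem_bot_iff_fixed]
    intro f
    obtain ⟨g, rfl⟩ := Ideal.Quotient.stabilizerHom_surjective G P Q f
    exact congrArg (Ideal.Quotient.mk Q) (hb g g.2)
  obtain ⟨a, ha⟩ := IntermediateField.mem_bot.mp h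
  obtain ⟨a, rfl⟩ := Ideal.Quotient.mk_surjective a
  exact ⟨a, Ideal.Quotient.eq.mp ha.symm⟩

/-- If two primes of `B` lie over `P`, the decomposition group of one of them is a proper
subgroup. -/
theorem Ideal.exists_fixedField_sub_algebraMap_mem {A K L B : Type*} [CommRing A] [CommRing B]
    [Field K] [Field L] [Algebra A K] [Algebra B L] [IsFractionRing A K] [IsFractionRing B L]
    [Algebra A B] [Algebra K L] [Algebra A L] [IsScalarTower A K L] [IsScalarTower A B L]
    [IsIntegrallyClosed A] [IsIntegralClosure B A L] [FiniteDimensional K L] [IsGalois K L]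
    [Module.Finite A B] (P : Ideal A) [P.IsMaximal] [CharZero (A ⧸ P)]
    (Q Q' : Ideal B) [Q.IsPrime] [Q'.IsPrime] (hQ : Q.under A = P) (hQ' : Q'.under A = P)
    (hne : Q ≠ Q') :
    ∃ H : Subgroup Gal(L/K), H ≠ ⊤ ∧ ∀ b : B,
      algebraMap B L b ∈ IntermediateField.fixedField H → ∃ a : A, b - algebraMap A B a ∈ Q := by
  let _ := IsIntegralClosure.MulSemiringAction A K L B
  have : Algebra.IsInvariant A B Gal(L/K) := Algebra.isInvariant_of_isGalois A K L B
  have : SMulCommClass Gal(L/K) A B := ⟨fun g a b ↦ by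
    rw [Algebra.smul_def, Algebra.smul_def, smul_mul']
    congr 1
    exact (galRestrict A K L B g).commutes a⟩
  have : Q.LiesOver P := ⟨hQ.symm⟩
  have : Q.IsMaximal := Ideal.IsMaximal.of_liesOver_isMaximal Q P
  refine ⟨MulAction.stabilizer Gal(L/K) Q, fun htop ↦ hne ?_, fun b hb ↦ ?_⟩
  · obtain ⟨g, hg⟩ := Algebra.IsInvariant.exists_smul_of_under_eq A B Gal(L/K) Q Q'
      (hQ.trans hQ'.symm)
    have : g ∈ MulAction.stabilizer Gal(L/K) Q := htop ▸ Subgroup.mem_top g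
    exact (hg.trans this).symm
  · refine Ideal.exists_sub_algebraMap_mem_of_fixed P Q (G := Gal(L/K)) fun g hg ↦ ?_
    apply IsFractionRing.injective B L
    exact (algebraMap_galRestrict_apply A g b).trans (hb ⟨g, hg⟩)

end Decomposition

/-! ### Generic unramifiedness -/

/-- A finite extension of domains with separable extension of fraction fields is unramified over
a nonempty basic open set of the base. -/
theorem Algebra.exists_formallyUnramified_away {A B : Type*} (K L : Type*) [CommRing A]
    [CommRing B] [IsDomain A] [IsDomain B]
    [Field K] [Field L] [Algebra A K] [Algebra B L] [IsFractionRing A K] [IsFractionRing B L]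
    [Algebra A B] [Algebra K L] [Algebra A L] [IsScalarTower A K L] [IsScalarTower A B L]
    [Algebra.IsSeparable K L] [Module.Finite A B] :
    ∃ a : A, a ≠ 0 ∧ Algebra.FormallyUnramified A (Localization.Away (algebraMap A B a)) := by
  have : Algebra.FormallyUnramified K L := .of_isSeparable K L
  have : Algebra.FormallyUnramified A K := .of_isLocalization (nonZeroDivisors A)
  have : Algebra.FormallyUnramified A L := .comp A K L
  have : Algebra.IsUnramifiedAt A (⊥ : Ideal B) := by
    have : IsLocalization (⊥ : Ideal B).primeCompl L := by
      rw [Ideal.primeCompl_bot]; infer_instance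
    exact .of_equiv ((IsLocalization.algEquiv (⊥ : Ideal B).primeCompl L
      (Localization.AtPrime (⊥ : Ideal B))).restrictScalars A)
  obtain ⟨b, hb0, hb⟩ := Algebra.exists_formallyUnramified_of_isUnramifiedAt (R := A) (⊥ : Ideal B)
  -- The integral element `b` divides a nonzero element of the base.
  obtain ⟨a, ha, ha0⟩ := Submodule.ne_bot_iff _ |>.mp <|
    Ideal.comap_ne_bot_of_integral_mem (R := A) (mt Ideal.mem_bot.mpr hb0)
      (Ideal.mem_span_singleton_self b) (Algebra.IsIntegral.isIntegral b)
  refine ⟨a, ha0, ?_⟩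
  rw [← Algebra.basicOpen_subset_unramifiedLocus_iff] at hb ⊢
  refine fun q hq ↦ hb fun hbq ↦ hq ?_
  exact Ideal.mem_of_dvd _ (Ideal.mem_span_singleton.mp ha) hbq

/-! ### Sections of relative normalizations -/

open Opposite

namespace AlgebraicGeometry

/-- The ring homomorphism `Γ(W, V) ⟶ F` attached to a morphism `j : Spec F ⟶ W` which factors
through the open subscheme `V`. For an `F`-point it is evaluation at that point, for the generic
point it is the germ map into the function field. -/
noncomputable def specEval {F : CommRingCat.{u}} {W : Scheme.{u}} (j : Spec F ⟶ W) (V : W.Opens)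
    (h : j ⁻¹ᵁ V = ⊤) : Γ(W, V) ⟶ F :=
  j.appLE V ⊤ h.ge ≫ (Scheme.ΓSpecIso F).hom

lemma specEval_comp {F : CommRingCat.{u}} {W W' : Scheme.{u}} (j : Spec F ⟶ W) (f : W ⟶ W')
    (V : W'.Opens) (h : (j ≫ f) ⁻¹ᵁ V = ⊤) (h' : j ⁻¹ᵁ f ⁻¹ᵁ V = ⊤) :
    specEval (j ≫ f) V h = f.app V ≫ specEval j (f ⁻¹ᵁ V) h' := by
  simp [specEval, Scheme.Hom.comp_appLE]

lemma specEval_comp_appLE {F : CommRingCat.{u}} {W W' : Scheme.{u}} (j : Spec F ⟶ W)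
    (f : W ⟶ W') (V : W'.Opens) (V' : W.Opens) (hV : V' ≤ f ⁻¹ᵁ V) (h : (j ≫ f) ⁻¹ᵁ V = ⊤)
    (h' : j ⁻¹ᵁ V' = ⊤) :
    specEval (j ≫ f) V h = f.appLE V V' hV ≫ specEval j V' h' := by
  simp [specEval, Scheme.Hom.appLE_comp_appLE_assoc]

lemma specEval_congr {F : CommRingCat.{u}} {W : Scheme.{u}} {j j' : Spec F ⟶ W} (hj : j = j')
    (V : W.Opens) (h : j ⁻¹ᵁ V = ⊤) (h' : j' ⁻¹ᵁ V = ⊤) : specEval j V h = specEval j' V h' := by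
  subst hj; rfl

lemma specEval_SpecMap_comp {E F : CommRingCat.{u}} {W : Scheme.{u}} (β : E ⟶ F)
    (j : Spec E ⟶ W) (V : W.Opens) (h : j ⁻¹ᵁ V = ⊤) (h' : (Spec.map β ≫ j) ⁻¹ᵁ V = ⊤) :
    specEval (Spec.map β ≫ j) V h' = specEval j V h ≫ β := by
  rw [specEval, specEval, Category.assoc, ← Scheme.ΓSpecIso_naturality,
    ← Scheme.Hom.appLE_comp_appLE (Spec.map β) j V ⊤ ⊤ h.ge le_top]
  simp [Scheme.Hom.app_eq_appLE, Scheme.Hom.appTop]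

lemma specEval_fromSpecStalk {W : Scheme.{u}} (x : W) (V : W.Opens)
    (h : (W.fromSpecStalk x) ⁻¹ᵁ V = ⊤) (hx : x ∈ V) :
    specEval (W.fromSpecStalk x) V h = W.presheaf.germ V x hx := by
  rw [specEval, Scheme.Hom.appLE, Scheme.fromSpecStalk_app hx, Category.assoc, Category.assoc,
    Category.assoc, ← Functor.map_comp_assoc, Subsingleton.elim (_ ≫ _) (𝟙 (op ⊤))]
  simp

/-- With `range_toNormalization_appLE`: over an affine open `U`, the sections of the relative
normalization are the integral closure of `Γ(X, U)`. The open set `W` equals `f ⁻¹ᵁ U`, and is a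
variable so that it may be taken to be `⊤`. -/
lemma toNormalization_appLE_injective {S X : Scheme.{u}} (f : S ⟶ X) [QuasiCompact f]
    [QuasiSeparated f] {U : X.Opens} (hU : IsAffineOpen U) {W : S.Opens} (hW : f ⁻¹ᵁ U = W)
    (h : W ≤ f.toNormalization ⁻¹ᵁ f.fromNormalization ⁻¹ᵁ U) :
    Function.Injective (f.toNormalization.appLE (f.fromNormalization ⁻¹ᵁ U) W h).hom := by
  subst hW
  rw [← f.normalizationObjIso_hom_val hU]
  have h1 : Function.Injective (f.normalizationObjIso hU).hom :=
    (ConcreteCategory.bijective_of_isIso _).1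
  exact Subtype.val_injective.comp h1

lemma range_toNormalization_appLE {S X : Scheme.{u}} (f : S ⟶ X) [QuasiCompact f]
    [QuasiSeparated f] {U : X.Opens} (hU : IsAffineOpen U) {W : S.Opens} (hW : f ⁻¹ᵁ U = W)
    (h : W ≤ f.toNormalization ⁻¹ᵁ f.fromNormalization ⁻¹ᵁ U) :
    Set.range (f.toNormalization.appLE (f.fromNormalization ⁻¹ᵁ U) W h).hom =
      {x | (f.appLE U W hW.ge).hom.IsIntegralElem x} := by
  subst hW
  rw [← f.normalizationObjIso_hom_val hU]
  have h1 : Function.Surjective (f.normalizationObjIso hU).hom :=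
    (ConcreteCategory.bijective_of_isIso _).2
  let _ := (f.app U).hom.toAlgebra
  simp only [← Scheme.Hom.app_eq_appLE]
  ext x
  constructor
  · rintro ⟨y, rfl⟩
    exact ((f.normalizationObjIso hU).hom y).2
  · intro hx
    obtain ⟨y, hy⟩ := h1 ⟨x, hx⟩
    exact ⟨y, congrArg Subtype.val hy⟩

lemma specEval_toNormalization_injective {F : CommRingCat.{u}} {X : Scheme.{u}} (f : Spec F ⟶ X)
    [QuasiCompact f] [QuasiSeparated f] {U : X.Opens} (hU : IsAffineOpen U) (h : f ⁻¹ᵁ U = ⊤)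
    {V : f.normalization.Opens} (hV : f.fromNormalization ⁻¹ᵁ U = V)
    (h' : f.toNormalization ⁻¹ᵁ V = ⊤) :
    Function.Injective (specEval f.toNormalization V h').hom := by
  subst hV
  exact ((ConcreteCategory.bijective_of_isIso (Scheme.ΓSpecIso F).hom).1).comp
    (toNormalization_appLE_injective f hU h h'.ge)

lemma range_specEval_toNormalization {F : CommRingCat.{u}} {X : Scheme.{u}} (f : Spec F ⟶ X)
    [QuasiCompact f] [QuasiSeparated f] {U : X.Opens} (hU : IsAffineOpen U) (h : f ⁻¹ᵁ U = ⊤)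
    {V : f.normalization.Opens} (hV : f.fromNormalization ⁻¹ᵁ U = V)
    (h' : f.toNormalization ⁻¹ᵁ V = ⊤) :
    Set.range (specEval f.toNormalization V h').hom =
      {x | (specEval f U h).hom.IsIntegralElem x} := by
  subst hV
  have hb := ConcreteCategory.bijective_of_isIso (Scheme.ΓSpecIso F).hom
  have := range_toNormalization_appLE f hU h h'.ge
  simp only [specEval, CommRingCat.hom_comp, RingHom.coe_comp, Set.range_comp, this]
  ext x
  constructor
  · rintro ⟨y, hy, rfl⟩
    exact RingHom.IsIntegralElem.map hy _
  · intro hx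
    obtain ⟨y, rfl⟩ := hb.2 x
    obtain ⟨p, hp, hpx⟩ := hx
    refine ⟨y, ⟨p, hp, hb.1 ?_⟩, rfl⟩
    rw [map_zero, ← hpx]
    exact Polynomial.hom_eval₂ _ _ (Scheme.ΓSpecIso F).hom.hom _

/-- A subring of a field which is the set of elements integral over some ring `A` is integrally
closed. -/
lemma isIntegrallyClosed_of_range_eq {A R E : Type*} [CommRing A] [CommRing R] [Field E]
    (a : A →+* E) (r : A →+* R) (e : R →+* E) (he : Function.Injective e) (hr : e.comp r = a)
    (hrange : Set.range e = {x | a.IsIntegralElem x}) : IsIntegrallyClosed R := by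
  have : IsDomain R := he.isDomain
  let _ := e.toAlgebra
  let _ := a.toAlgebra
  let _ := r.toAlgebra
  have : FaithfulSMul R E := (faithfulSMul_iff_algebraMap_injective R E).mpr he
  have : IsScalarTower A R E := .of_algebraMap_eq' hr.symm
  have hint : Algebra.IsIntegral A R := ⟨fun x ↦ by
    rw [← isIntegral_algebraMap_iff (B := E) he]
    exact hrange.le ⟨x, rfl⟩⟩
  have : IsIntegrallyClosedIn R E := by
    rw [isIntegrallyClosedIn_iff]
    refine ⟨he, fun {x} hx ↦ ?_⟩
    exact hrange.ge (isIntegral_trans (R := A) x hx)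
  exact IsIntegrallyClosed.of_isIntegrallyClosedIn R E

end AlgebraicGeometry

/-! ### Stalks and sections of normal schemes -/

namespace AlgebraicGeometry

lemma Scheme.isSeparated_of_isSeparated_hom {X S : Scheme.{u}} [S.IsSeparated] (s : X ⟶ S)
    [IsSeparated s] : X.IsSeparated := by
  rw [Scheme.isSeparated_iff, ← terminal.comp_from s]
  infer_instance

lemma surjective_SpecMap_of_field {E F : Type u} [Field E] [Field F]
    (f : CommRingCat.of E ⟶ CommRingCat.of F) : Surjective (Spec.map f) :=
  ⟨fun _ ↦ ⟨(⊥ : PrimeSpectrum F), Subsingleton.elim (α := PrimeSpectrum E) _ _⟩⟩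

lemma isIntegrallyClosed_stalk_of_isAffineOpen {X : Scheme.{u}} [IsIntegral X] {U : X.Opens}
    (hU : IsAffineOpen U) {x : X} (hx : x ∈ U) [IsIntegrallyClosed Γ(X, U)] :
    IsIntegrallyClosed (X.presheaf.stalk x) := by
  have : Nonempty U := ⟨x, hx⟩
  have := hU.isLocalization_stalk ⟨x, hx⟩
  let _ := X.presheaf.algebra_section_stalk (⟨x, hx⟩ : U)
  exact isIntegrallyClosed_of_isLocalization (X.presheaf.stalk x)
    (hU.primeIdealOf ⟨x, hx⟩).asIdeal.primeCompl (Ideal.primeCompl_le_nonZeroDivisors _)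

lemma IsAffineOpen.isIntegrallyClosed {X : Scheme.{u}} [IsIntegral X]
    (hX : ∀ x : X, IsIntegrallyClosed (X.presheaf.stalk x)) {U : X.Opens}
    (hU : IsAffineOpen U) [Nonempty U] : IsIntegrallyClosed Γ(X, U) := by
  have key (q : PrimeSpectrum Γ(X, U)) : IsIntegrallyClosed (Localization.AtPrime q.asIdeal) := by
    obtain ⟨x, rfl⟩ : ∃ x, hU.primeIdealOf x = q :=
      ⟨⟨hU.fromSpec q, hU.range_fromSpec.le ⟨q, rfl⟩⟩,
        hU.fromSpec.isOpenEmbedding.injective (hU.fromSpec_primeIdealOf _)⟩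
    have := hU.isLocalization_stalk x
    let _ := X.presheaf.algebra_section_stalk x
    have := hX x
    exact .of_equiv (IsLocalization.algEquiv (hU.primeIdealOf x).asIdeal.primeCompl
      (X.presheaf.stalk x.1) (Localization.AtPrime (hU.primeIdealOf x).asIdeal)).toRingEquiv
  exact IsIntegrallyClosed.of_localization_maximal fun p _ _ ↦ key ⟨p, inferInstance⟩

end AlgebraicGeometry

/-! ### Normalization in the function field -/

namespace AlgebraicGeometry

section

variable {X Z : Scheme.{u}} [IsIntegral X] [IsIntegral Z] (π : Z ⟶ X)

/-- The inclusion of the generic point `Spec K(X) ⟶ X` of an integral scheme. -/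
noncomputable abbrev fromSpecFunctionField (X : Scheme.{u}) [IsIntegral X] :
    Spec X.functionField ⟶ X := X.fromSpecStalk (genericPoint X)

lemma fromSpecFunctionField_preimage (U : X.Opens) [hU : Nonempty U] :
    fromSpecFunctionField X ⁻¹ᵁ U = ⊤ := by
  obtain ⟨x, hx⟩ := hU
  refine top_unique fun y _ ↦ ?_
  have hy : fromSpecFunctionField X y ⤳ genericPoint X :=
    Scheme.range_fromSpecStalk.le ⟨y, rfl⟩
  exact (hy.trans (genericPoint_specializes x)).mem_open U.2 hx

lemma specEval_fromSpecFunctionField (U : X.Opens) [Nonempty U]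
    (h : fromSpecFunctionField X ⁻¹ᵁ U = ⊤) :
    specEval (fromSpecFunctionField X) U h =
      X.germToFunctionField U :=
  specEval_fromSpecStalk _ _ _ _

lemma SpecMap_functionFieldMap [IsDominant π] :
    Spec.map (functionFieldMap π) ≫ fromSpecFunctionField X = fromSpecFunctionField Z ≫ π := by
  rw [functionFieldMap, Spec.map_comp, Category.assoc,
    Scheme.SpecMap_stalkSpecializes_fromSpecStalk, Scheme.SpecMap_stalkMap_fromSpecStalk]

lemma germToFunctionField_functionFieldMap [IsDominant π] (U : X.Opens) [Nonempty U]
    [Nonempty (π ⁻¹ᵁ U)] :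
    X.germToFunctionField U ≫ functionFieldMap π =
      π.app U ≫ Z.germToFunctionField (π ⁻¹ᵁ U) := by
  have h1 := fromSpecFunctionField_preimage U
  have h2' := fromSpecFunctionField_preimage (π ⁻¹ᵁ U)
  have h2 : (fromSpecFunctionField Z ≫ π) ⁻¹ᵁ U = ⊤ := by rw [Scheme.Hom.comp_preimage, h2']
  have h3 : (Spec.map (functionFieldMap π) ≫ fromSpecFunctionField X) ⁻¹ᵁ U = ⊤ := by
    rwa [SpecMap_functionFieldMap]
  rw [← specEval_fromSpecFunctionField U h1, ← specEval_fromSpecFunctionField (π ⁻¹ᵁ U) h2']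
  exact (specEval_SpecMap_comp (functionFieldMap π) (fromSpecFunctionField X) U h1 h3).symm.trans
    ((specEval_congr (SpecMap_functionFieldMap π) U h3 h2).trans
      (specEval_comp (fromSpecFunctionField Z) π U h2 h2'))

omit [IsIntegral X] [IsIntegral Z] in
lemma nonempty_preimage [Surjective π] (U : X.Opens) [Nonempty U] : Nonempty (π ⁻¹ᵁ U) := by
  obtain ⟨x, hx⟩ := ‹Nonempty U›
  obtain ⟨z, rfl⟩ := π.surjective x
  exact ⟨z, hx⟩

omit [IsIntegral X] in
/-- A normal scheme `Z`, integral over `X`, is the relative normalization of `X` in the generic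
point of `Z`. -/
lemma isIso_normalizationDesc [Surjective π] [IsIntegralHom π]
    (hZ : ∀ z : Z, IsIntegrallyClosed (Z.presheaf.stalk z))
    [QuasiCompact (fromSpecFunctionField Z ≫ π)] [QuasiSeparated (fromSpecFunctionField Z ≫ π)] :
    IsIso ((fromSpecFunctionField Z ≫ π).normalizationDesc (fromSpecFunctionField Z) π rfl) := by
  let j := fromSpecFunctionField Z
  let f := j ≫ π
  let h := f.normalizationDesc j π rfl
  have hh : f.toNormalization ≫ h = j := f.toNormalization_normalizationDesc j π rfl
  have hπ : h ≫ π = f.fromNormalization := f.normalizationDesc_comp j π rfl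
  apply IsZariskiLocalAtTarget.of_forall_exists_morphismRestrict (P := .isomorphisms _) fun z ↦ ?_
  obtain ⟨_, ⟨U, hU, rfl⟩, hzU, -⟩ := X.isBasis_affineOpens.exists_subset_of_mem_open
    (Set.mem_univ (π z)) isOpen_univ
  have : Nonempty U := ⟨_, hzU⟩
  have : Nonempty (π ⁻¹ᵁ U) := ⟨z, hzU⟩
  have hW := hU.preimage π
  refine ⟨π ⁻¹ᵁ U, hzU, (isIso_morphismRestrict_iff_isIso_app _ hW).mpr ?_⟩
  rw [ConcreteCategory.isIso_iff_bijective]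
  have hjU : j ⁻¹ᵁ π ⁻¹ᵁ U = ⊤ := fromSpecFunctionField_preimage (π ⁻¹ᵁ U)
  have hfU : f ⁻¹ᵁ U = ⊤ := by rw [Scheme.Hom.comp_preimage, hjU]
  have h1 : f.toNormalization ⁻¹ᵁ h ⁻¹ᵁ π ⁻¹ᵁ U = ⊤ := by
    rw [← Scheme.Hom.comp_preimage, hh, hjU]
  have hV : f.fromNormalization ⁻¹ᵁ U = h ⁻¹ᵁ π ⁻¹ᵁ U := by
    rw [← Scheme.Hom.comp_preimage, hπ]
  have hinj := specEval_toNormalization_injective f hU hfU hV h1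
  have hrange := range_specEval_toNormalization f hU hfU hV h1
  have hcomp : h.app (π ⁻¹ᵁ U) ≫ specEval f.toNormalization (h ⁻¹ᵁ π ⁻¹ᵁ U) h1 =
      Z.germToFunctionField (π ⁻¹ᵁ U) := by
    have h3 : (f.toNormalization ≫ h) ⁻¹ᵁ π ⁻¹ᵁ U = ⊤ := by
      rw [Scheme.Hom.comp_preimage, h1]
    rw [← specEval_fromSpecFunctionField (π ⁻¹ᵁ U) hjU]
    exact (specEval_comp f.toNormalization h (π ⁻¹ᵁ U) h3 h1).symm.trans
      (specEval_congr hh (π ⁻¹ᵁ U) h3 hjU)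
  have hcomp' (b) : specEval f.toNormalization (h ⁻¹ᵁ π ⁻¹ᵁ U) h1 (h.app (π ⁻¹ᵁ U) b) =
    Z.germToFunctionField (π ⁻¹ᵁ U) b := ConcreteCategory.congr_hom hcomp b
  constructor
  · intro b b' hb
    exact Scheme.germToFunctionField_injective Z (π ⁻¹ᵁ U)
      ((hcomp' b).symm.trans ((congrArg _ hb).trans (hcomp' b')))
  · intro y
    have := hW.isIntegrallyClosed hZ
    have := functionField_isFractionRing_of_isAffineOpen Z (π ⁻¹ᵁ U) hW
    have hy : (specEval f U hfU).hom.IsIntegralElem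
      (specEval f.toNormalization (h ⁻¹ᵁ π ⁻¹ᵁ U) h1 y) := hrange.le ⟨y, rfl⟩
    have hy' : _root_.IsIntegral Γ(Z, π ⁻¹ᵁ U)
        (specEval f.toNormalization (h ⁻¹ᵁ π ⁻¹ᵁ U) h1 y) := by
      rw [specEval_comp j π U hfU hjU, specEval_fromSpecFunctionField] at hy
      exact RingHom.IsIntegralElem.of_comp hy
    obtain ⟨b, hb⟩ := IsIntegrallyClosed.isIntegral_iff.mp hy'
    exact ⟨b, hinj ((hcomp' b).trans hb)⟩

end

end AlgebraicGeometry

/-! ### Covers attached to intermediate fields -/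

namespace AlgebraicGeometry

lemma _root_.RingHom.Finite.of_finite_comp_of_injective {A B C : Type*} [CommRing A] [CommRing B]
    [CommRing C] [IsNoetherianRing A] (a : A →+* C) (i : C →+* B) (hi : Function.Injective i)
    (h : (i.comp a).Finite) : a.Finite := by
  algebraize [a, i, i.comp a]
  exact Module.Finite.of_injective (IsScalarTower.toAlgHom A C B).toLinearMap hi

lemma _root_.RingHom.IsIntegralElem.of_comp_of_injective {A B C : Type*} [CommRing A] [CommRing B]
    [CommRing C] (a : A →+* C) (i : C →+* B) (hi : Function.Injective i) {x : C}
    (h : (i.comp a).IsIntegralElem (i x)) : a.IsIntegralElem x := by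
  obtain ⟨p, hp, hpx⟩ := h
  exact ⟨p, hp, hi (by rw [map_zero, Polynomial.hom_eval₂, hpx])⟩

/-- A field `E` between `K(X)` and `K(Z)` gives a factorization of the cover `Z ⟶ X` into covers
`Z ⟶ Y ⟶ X`, where `Y` is the normalization of `X` in `E`: over an affine open `U` of `X`, the
sections of `Y` are the sections of `Z` which lie in `E`. -/
theorem exists_intermediate_cover {k : Type u} [Field k] {X Z : Scheme.{u}}
    (s : X ⟶ Spec (.of k)) (π : Z ⟶ X) [IsCover s π] [IsIntegral X] [IsIntegral Z]
    [IsDominant π] {E : Type u} [Field E] (α : X.functionField ⟶ .of E)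
    (β : .of E ⟶ Z.functionField) (hαβ : α ≫ β = functionFieldMap π) :
    ∃ (Y : Scheme.{u}) (f : Z ⟶ Y) (g : Y ⟶ X) (hfg : f ≫ g = π),
      IsCover (g ≫ s) f ∧ IsCover s g ∧
      ∀ (U : X.Opens) [Nonempty U] [Nonempty (π ⁻¹ᵁ U)], IsAffineOpen U → ∀ b : Γ(Z, π ⁻¹ᵁ U),
        Z.germToFunctionField (π ⁻¹ᵁ U) b ∈ Set.range β.hom ↔
          b ∈ Set.range (f.appLE (g ⁻¹ᵁ U) (π ⁻¹ᵁ U)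
            (by rw [← hfg, Scheme.Hom.comp_preimage])).hom := by
  have hX : IsNormalVariety s := IsCover.target π
  have hZ : IsNormalVariety (π ≫ s) := IsCover.source
  have : IsFinite π := IsCover.isFinite s
  have : Surjective π := IsCover.surjective s
  have := hX.isSeparated
  have := hX.locallyOfFiniteType
  have := hX.quasiCompact
  have : X.IsSeparated := Scheme.isSeparated_of_isSeparated_hom s
  have : IsLocallyNoetherian X := LocallyOfFiniteType.isLocallyNoetherian s
  let j := fromSpecFunctionField Z
  let fL : Spec Z.functionField ⟶ X := j ≫ π
  let h := fL.normalizationDesc j π rfl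
  have hhiso : IsIso h := isIso_normalizationDesc π hZ.isIntegrallyClosed_stalk
  have hh : fL.toNormalization ≫ h = j := fL.toNormalization_normalizationDesc j π rfl
  have hπ : h ≫ π = fL.fromNormalization := fL.normalizationDesc_comp j π rfl
  let fE : Spec (.of E) ⟶ X := Spec.map α ≫ fromSpecFunctionField X
  let Y := fE.normalization
  let g : Y ⟶ X := fE.fromNormalization
  let t : Spec (.of E) ⟶ Y := fE.toNormalization
  have htg : t ≫ g = fE := fE.toNormalization_fromNormalization
  have hβ : Spec.map β ≫ fE = fL := by
    rw [← Spec.map_comp_assoc, hαβ, SpecMap_functionFieldMap]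
  have H : fL = (Spec.map β ≫ t) ≫ g := by rw [Category.assoc, htg, hβ]
  let d : fL.normalization ⟶ Y := fL.normalizationDesc (Spec.map β ≫ t) g H
  have htd : fL.toNormalization ≫ d = Spec.map β ≫ t :=
    fL.toNormalization_normalizationDesc (Spec.map β ≫ t) g H
  have hdg : d ≫ g = fL.fromNormalization := fL.normalizationDesc_comp (Spec.map β ≫ t) g H
  let f : Z ⟶ Y := inv h ≫ d
  have hfg : f ≫ g = π := by
    rw [Category.assoc, hdg, ← hπ, IsIso.inv_hom_id_assoc]
  have hjf : j ≫ f = Spec.map β ≫ t := by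
    have : j ≫ f = (fL.toNormalization ≫ h) ≫ inv h ≫ d := congrArg (· ≫ f) hh.symm
    rw [← htd, this, Category.assoc, IsIso.hom_inv_id_assoc]
  have hE : IsIntegral (Spec (.of E)) := inferInstance
  have hYint : IsIntegral Y := inferInstanceAs (IsIntegral fE.normalization)
  have : IsIntegralHom g := inferInstanceAs (IsIntegralHom fE.fromNormalization)
  have hfU (U : X.Opens) [Nonempty U] : fE ⁻¹ᵁ U = ⊤ := by
    rw [Scheme.Hom.comp_preimage, fromSpecFunctionField_preimage, Scheme.Hom.preimage_top]
  have htU (U : X.Opens) [Nonempty U] : t ⁻¹ᵁ g ⁻¹ᵁ U = ⊤ := by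
    rw [← Scheme.Hom.comp_preimage, htg, hfU]
  have hle (U : X.Opens) : π ⁻¹ᵁ U ≤ f ⁻¹ᵁ g ⁻¹ᵁ U := by
    rw [← hfg, Scheme.Hom.comp_preimage]
  have hinj (U : X.Opens) [Nonempty U] (hU : IsAffineOpen U) :
      Function.Injective (specEval t (g ⁻¹ᵁ U) (htU U)).hom :=
    specEval_toNormalization_injective fE hU (hfU U) rfl (htU U)
  have hrange (U : X.Opens) [Nonempty U] (hU : IsAffineOpen U) :
      Set.range (specEval t (g ⁻¹ᵁ U) (htU U)).hom =
        {x | (specEval fE U (hfU U)).hom.IsIntegralElem x} :=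
    range_specEval_toNormalization fE hU (hfU U) rfl (htU U)
  have hcomp (U : X.Opens) [Nonempty U] :
      g.app U ≫ specEval t (g ⁻¹ᵁ U) (htU U) = specEval fE U (hfU U) := by
    have h1 : (t ≫ g) ⁻¹ᵁ U = ⊤ := by rw [htg, hfU]
    exact (specEval_comp t g U h1 (htU U)).symm.trans (specEval_congr htg U h1 (hfU U))
  have hgerm (U : X.Opens) [Nonempty U] [Nonempty (π ⁻¹ᵁ U)] :
      f.appLE (g ⁻¹ᵁ U) (π ⁻¹ᵁ U) (hle U) ≫ Z.germToFunctionField (π ⁻¹ᵁ U) =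
        specEval t (g ⁻¹ᵁ U) (htU U) ≫ β := by
    have h1 : j ⁻¹ᵁ π ⁻¹ᵁ U = ⊤ := fromSpecFunctionField_preimage (π ⁻¹ᵁ U)
    have h2 : (Spec.map β ≫ t) ⁻¹ᵁ g ⁻¹ᵁ U = ⊤ := by
      rw [Scheme.Hom.comp_preimage, htU, Scheme.Hom.preimage_top]
    have h3 : (j ≫ f) ⁻¹ᵁ g ⁻¹ᵁ U = ⊤ := by rw [hjf, h2]
    rw [← specEval_fromSpecFunctionField (π ⁻¹ᵁ U) h1]
    exact (specEval_comp_appLE j f (g ⁻¹ᵁ U) (π ⁻¹ᵁ U) (hle U) h3 h1).symm.trans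
      ((specEval_congr hjf (g ⁻¹ᵁ U) h3 h2).trans (specEval_SpecMap_comp β t (g ⁻¹ᵁ U) (htU U) h2))
  have hπgerm (U : X.Opens) [Nonempty U] [Nonempty (π ⁻¹ᵁ U)] :
      π.app U ≫ Z.germToFunctionField (π ⁻¹ᵁ U) = specEval fE U (hfU U) ≫ β := by
    have h1 : fL ⁻¹ᵁ U = ⊤ := by
      rw [Scheme.Hom.comp_preimage, fromSpecFunctionField_preimage]
    have h2 : (Spec.map β ≫ fE) ⁻¹ᵁ U = ⊤ := by rw [hβ, h1]
    rw [← germToFunctionField_functionFieldMap, ← hαβ,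
      ← specEval_fromSpecFunctionField U (fromSpecFunctionField_preimage U), ← Category.assoc]
    congr 1
    exact (specEval_SpecMap_comp α (fromSpecFunctionField X) U _ (hfU U)).symm
  have hYn (y : Y) : IsIntegrallyClosed (Y.presheaf.stalk y) := by
    obtain ⟨_, ⟨U, hU, rfl⟩, hyU, -⟩ := X.isBasis_affineOpens.exists_subset_of_mem_open
      (Set.mem_univ (g y)) isOpen_univ
    have : Nonempty U := ⟨_, hyU⟩
    have : IsIntegrallyClosed Γ(Y, g ⁻¹ᵁ U) :=
      isIntegrallyClosed_of_range_eq (specEval fE U (hfU U)).hom (g.app U).hom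
        (specEval t (g ⁻¹ᵁ U) (htU U)).hom (hinj U hU)
        (congrArg CommRingCat.Hom.hom (hcomp U)) (hrange U hU)
    exact isIntegrallyClosed_stalk_of_isAffineOpen (hU.preimage g) hyU
  -- Over an affine open, the sections of `Y` embed into those of `Z`, which form a finite module
  -- over a Noetherian ring.
  have hgfin : IsFinite g := by
    refine ⟨fun U hU ↦ ?_⟩
    obtain hU0 | _ := isEmpty_or_nonempty U
    · have : Subsingleton Γ(Y, g ⁻¹ᵁ U) := by
        have h1 : g ⁻¹ᵁ U = ⊥ := by
          ext y
          exact ⟨fun hy ↦ (hU0.false ⟨_, hy⟩).elim, fun hy ↦ hy.elim⟩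
        rw [h1]
        infer_instance
      let _ := (g.app U).hom.toAlgebra
      exact inferInstanceAs (Module.Finite Γ(X, U) Γ(Y, g ⁻¹ᵁ U))
    · have := nonempty_preimage π U
      have : IsNoetherianRing Γ(X, U) := IsLocallyNoetherian.component_noetherian ⟨U, hU⟩
      refine RingHom.Finite.of_finite_comp_of_injective (g.app U).hom
        (f.appLE (g ⁻¹ᵁ U) (π ⁻¹ᵁ U) (hle U)).hom ?_ ?_
      · have h1 : Function.Injective (specEval t (g ⁻¹ᵁ U) (htU U) ≫ β).hom :=
          β.hom.injective.comp (hinj U hU)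
        rw [← hgerm U] at h1
        exact Function.Injective.of_comp h1
      · have := IsFinite.finite_app (f := π) U hU
        rw [← CommRingCat.hom_comp, Scheme.Hom.app_eq_appLE, Scheme.Hom.appLE_comp_appLE]
        simpa only [hfg, Scheme.Hom.app_eq_appLE] using this
  have : IsFinite (f ≫ g) := by rw [hfg]; infer_instance
  have : IsFinite f := .of_comp f g
  have : IsDominant f := by
    have := surjective_SpecMap_of_field (E := E) (F := Z.functionField) β
    have : IsDominant t := inferInstanceAs (IsDominant fE.toNormalization)
    have : IsDominant (j ≫ f) := by rw [hjf]; infer_instance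
    exact .of_comp j f
  have : Surjective f := .of_universallyClosed_of_isDominant f
  have : Surjective (f ≫ g) := by rw [hfg]; infer_instance
  have : Surjective g := .of_comp f g
  have hY : IsNormalVariety (g ≫ s) :=
    ⟨hYint, inferInstance, inferInstance, inferInstance, hYn⟩
  refine ⟨Y, f, g, hfg, ⟨hY, ?_, inferInstance, inferInstance⟩,
    ⟨hX, hY, inferInstance, inferInstance⟩, fun U _ _ hU b ↦ ⟨?_, ?_⟩⟩
  · rwa [← Category.assoc, hfg]
  · rintro ⟨e, he⟩
    have hint : (specEval fE U (hfU U)).hom.IsIntegralElem e := by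
      refine RingHom.IsIntegralElem.of_comp_of_injective _ β.hom β.hom.injective ?_
      rw [he, ← CommRingCat.hom_comp, ← hπgerm U]
      exact RingHom.IsIntegralElem.map (IsIntegralHom.isIntegral_app (f := π) U hU b) _
    obtain ⟨c, rfl⟩ := (hrange U hU).ge hint
    refine ⟨c, Scheme.germToFunctionField_injective Z (π ⁻¹ᵁ U) ?_⟩
    exact (ConcreteCategory.congr_hom (hgerm U) c).trans he
  · rintro ⟨c, rfl⟩
    exact ⟨specEval t (g ⁻¹ᵁ U) (htU U) c, (ConcreteCategory.congr_hom (hgerm U) c).symm⟩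

end AlgebraicGeometry

/-! ### Unramified covers, reduced fibres and rational points -/

namespace AlgebraicGeometry

lemma app_injective_of_isIntegral {X Z : Scheme.{u}} [IsIntegral X] [IsIntegral Z] (π : Z ⟶ X)
    [IsDominant π] (U : X.Opens) [Nonempty U] [Nonempty (π ⁻¹ᵁ U)] :
    Function.Injective (π.app U).hom := by
  have h : Function.Injective (X.germToFunctionField U ≫ functionFieldMap π).hom :=
    (functionFieldMap π).hom.injective.comp (Scheme.germToFunctionField_injective X U)
  rw [germToFunctionField_functionFieldMap] at h
  exact Function.Injective.of_comp h

lemma finiteDimensional_functionField {X Z : Scheme.{u}} [IsIntegral X] [IsIntegral Z] (π : Z ⟶ X)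
    [IsFinite π] [Surjective π] [Algebra X.functionField Z.functionField]
    (halg : algebraMap X.functionField Z.functionField = (functionFieldMap π).hom) :
    FiniteDimensional X.functionField Z.functionField := by
  obtain ⟨_, ⟨U, hU, rfl⟩, hxU, -⟩ := X.isBasis_affineOpens.exists_subset_of_mem_open
    (Set.mem_univ (genericPoint X)) isOpen_univ
  have : Nonempty U := ⟨_, hxU⟩
  have := nonempty_preimage π U
  have := functionField_isFractionRing_of_isAffineOpen X U hU
  have := functionField_isFractionRing_of_isAffineOpen Z (π ⁻¹ᵁ U) (hU.preimage π)
  let _ : Algebra Γ(X, U) Γ(Z, π ⁻¹ᵁ U) := (π.app U).hom.toAlgebra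
  let _ : Algebra Γ(X, U) Z.functionField :=
    ((algebraMap _ _).comp (algebraMap Γ(X, U) Γ(Z, π ⁻¹ᵁ U))).toAlgebra
  have : IsScalarTower Γ(X, U) Γ(Z, π ⁻¹ᵁ U) Z.functionField := .of_algebraMap_eq' rfl
  have : IsScalarTower Γ(X, U) X.functionField Z.functionField := .of_algebraMap_eq' <| by
    rw [halg]
    exact congrArg CommRingCat.Hom.hom (germToFunctionField_functionFieldMap π U).symm
  have : FaithfulSMul Γ(X, U) Γ(Z, π ⁻¹ᵁ U) :=
    (faithfulSMul_iff_algebraMap_injective _ _).mpr (app_injective_of_isIntegral π U)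
  have : Module.Finite Γ(X, U) Γ(Z, π ⁻¹ᵁ U) := IsFinite.finite_app (f := π) U hU
  have : IsLocalization (Algebra.algebraMapSubmonoid Γ(Z, π ⁻¹ᵁ U) (nonZeroDivisors Γ(X, U)))
    Z.functionField := inferInstance
  exact Module.Finite.of_isLocalization Γ(X, U) Γ(Z, π ⁻¹ᵁ U) (nonZeroDivisors Γ(X, U))

/-- Over a field of characteristic zero, an unramified cover of normal varieties is étale. -/
theorem IsCover.etale_of_formallyUnramified {k : Type u} [Field k] [CharZero k] {X Y : Scheme.{u}}
    (s : X ⟶ Spec (.of k)) (g : Y ⟶ X) [IsCover s g] [FormallyUnramified g] : Etale g := by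
  have hX : IsNormalVariety s := IsCover.target g
  have hY : IsNormalVariety (g ≫ s) := IsCover.source
  have : IsFinite g := IsCover.isFinite s
  have : Surjective g := IsCover.surjective s
  have := hX.isIntegral
  have := hY.isIntegral
  have := hX.locallyOfFiniteType
  have : IsLocallyNoetherian X := LocallyOfFiniteType.isLocallyNoetherian s
  have : LocallyOfFinitePresentation g :=
    LocallyOfFinitePresentation.iff_locallyOfFiniteType.mpr inferInstance
  suffices Flat g from .of_formallyUnramified_of_flat g
  refine (HasRingHomProperty.iff_exists_appLE (P := @Flat)
    (RingHom.Flat.stableUnderComposition.stableUnderCompositionWithLocalizationAway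
      RingHom.Flat.holdsForLocalizationAway).1).mpr
    fun y ↦ ?_
  obtain ⟨_, ⟨U, hU, rfl⟩, hxU, -⟩ := X.isBasis_affineOpens.exists_subset_of_mem_open
    (Set.mem_univ (g y)) isOpen_univ
  have : Nonempty U := ⟨_, hxU⟩
  have : Nonempty (g ⁻¹ᵁ U) := ⟨y, hxU⟩
  refine ⟨⟨U, hU⟩, ⟨g ⁻¹ᵁ U, hU.preimage g⟩, hxU, le_rfl, ?_⟩
  rw [← Scheme.Hom.app_eq_appLE]
  have hunr := HasRingHomProperty.appLE @FormallyUnramified g inferInstance ⟨U, hU⟩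
    ⟨g ⁻¹ᵁ U, hU.preimage g⟩ le_rfl
  rw [← Scheme.Hom.app_eq_appLE] at hunr
  have := hU.isIntegrallyClosed hX.isIntegrallyClosed_stalk
  let _ : Algebra k Γ(X, U) := ((Scheme.ΓSpecIso (.of k)).inv ≫ s.appLE ⊤ U le_top).hom.toAlgebra
  let _ : Algebra Γ(X, U) Γ(Y, g ⁻¹ᵁ U) := (g.app U).hom.toAlgebra
  have : FaithfulSMul Γ(X, U) Γ(Y, g ⁻¹ᵁ U) :=
    (faithfulSMul_iff_algebraMap_injective _ _).mpr (app_injective_of_isIntegral g U)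
  have : Module.Finite Γ(X, U) Γ(Y, g ⁻¹ᵁ U) := IsFinite.finite_app (f := g) U hU
  have : Algebra.FormallyUnramified Γ(X, U) Γ(Y, g ⁻¹ᵁ U) := hunr
  exact Algebra.FormallyUnramified.flat_of_isIntegrallyClosed k

lemma SpecMap_specEval_fromSpec {F : CommRingCat.{u}} {W : Scheme.{u}} (j : Spec F ⟶ W)
    {V : W.Opens} (hV : IsAffineOpen V) (h : j ⁻¹ᵁ V = ⊤) :
    Spec.map (specEval j V h) ≫ hV.fromSpec = j := by
  rw [specEval, Spec.map_comp, Category.assoc,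
    IsAffineOpen.SpecMap_appLE_fromSpec j hV (isAffineOpen_top _) h.ge, IsAffineOpen.fromSpec_top]
  simp

/-- If `A → C / θ⁻¹ Q` is surjective and `θ⁻¹ Q` lies over `ker φ`, then `φ` extends to `C`. -/
lemma _root_.RingHom.exists_comp_eq_of_sub_mem {A B C k : Type*} [CommRing A] [CommRing B]
    [CommRing C] [Field k] (φ : A →+* k) (ι : A →+* C) (θ : C →+* B) (Q : Ideal B)
    (hQ : ∀ a, θ (ι a) ∈ Q → φ a = 0) (h : ∀ c, ∃ a, θ c - θ (ι a) ∈ Q) :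
    ∃ ψ : C →+* k, ψ.comp ι = φ := by
  let χ : A →+* C ⧸ Q.comap θ := (Ideal.Quotient.mk _).comp ι
  have hχ : Function.Surjective χ := by
    intro c
    obtain ⟨c, rfl⟩ := Ideal.Quotient.mk_surjective c
    obtain ⟨a, ha⟩ := h c
    refine ⟨a, (Ideal.Quotient.eq.mpr ?_).symm⟩
    rwa [Ideal.mem_comap, map_sub]
  have hker : RingHom.ker χ ≤ RingHom.ker φ := fun a ha ↦
    hQ a (Ideal.Quotient.eq_zero_iff_mem.mp ha : ι a ∈ Q.comap θ)
  refine ⟨(χ.liftOfSurjective hχ ⟨φ, hker⟩).comp (Ideal.Quotient.mk _), RingHom.ext fun a ↦ ?_⟩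
  exact RingHom.liftOfRightInverse_comp_apply χ _ (Function.rightInverse_surjInv hχ) ⟨φ, hker⟩ a

lemma formallyUnramified_of_isOpenImmersion {X Y : Scheme.{u}} (f : X ⟶ Y) [IsOpenImmersion f] :
    FormallyUnramified f :=
  have : Etale f := inferInstance
  inferInstance

lemma isReduced_of_formallyUnramified_of_field {k : Type u} [Field k] {T : Scheme.{u}}
    (f : T ⟶ Spec (.of k)) [FormallyUnramified f] [LocallyOfFiniteType f] : IsReduced T := by
  have h (i : T.affineOpenCover.openCover.I₀) : IsReduced (T.affineOpenCover.openCover.X i) := by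
    change IsReduced (Spec (T.affineOpenCover.X i))
    obtain ⟨φ, hφ⟩ := Spec.map_surjective (T.affineOpenCover.f i ≫ f)
    have : IsOpenImmersion (T.affineOpenCover.f i) := T.affineOpenCover.map_prop i
    have h1 : FormallyUnramified (Spec.map φ) := by
      rw [hφ]
      exact MorphismProperty.comp_mem @FormallyUnramified _ _
        (formallyUnramified_of_isOpenImmersion _) inferInstance
    have h2 : LocallyOfFiniteType (Spec.map φ) := by rw [hφ]; infer_instance
    rw [HasRingHomProperty.Spec_iff (P := @FormallyUnramified)] at h1
    rw [HasRingHomProperty.Spec_iff (P := @LocallyOfFiniteType)] at h2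
    algebraize [φ.hom]
    have := Algebra.FormallyUnramified.isReduced_of_field k (T.affineOpenCover.X i)
    infer_instance
  exact IsReduced.of_openCover _ T.affineOpenCover.openCover

/-- If the first projection of a fibre product factors through a monomorphism `m`, then the fibre
product is unchanged by restriction along `m`. -/
lemma isPullback_of_mono {P X Y Z V : Scheme.{u}} {fst : P ⟶ X} {snd : P ⟶ Y} {f : X ⟶ Z}
    {g : Y ⟶ Z} (h : IsPullback fst snd f g) (m : V ⟶ X) [Mono m] (q : P ⟶ V) (hq : q ≫ m = fst) :
    IsPullback q snd (m ≫ f) g := by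
  refine ⟨⟨by rw [reassoc_of% hq, h.w]⟩, ⟨PullbackCone.IsLimit.mk _
    (fun t ↦ h.lift (t.fst ≫ m) t.snd (by simpa using t.condition)) (fun t ↦ ?_) (fun t ↦ ?_)
    fun t r hr hr' ↦ ?_⟩⟩
  · rw [← cancel_mono m, Category.assoc, hq, h.lift_fst]
  · simp
  · apply h.hom_ext
    · rw [h.lift_fst, ← hq, reassoc_of% hr]
    · simpa using hr'

/-- A finite cover with separable extension of function fields is generically unramified, so its
fibres over field-valued points of a nonempty open set are reduced. -/
theorem exists_isReduced_pullback {X Z : Scheme.{u}} [IsIntegral X] [IsIntegral Z] (π : Z ⟶ X)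
    [IsFinite π] [Surjective π] [Algebra X.functionField Z.functionField]
    (halg : algebraMap X.functionField Z.functionField = (functionFieldMap π).hom)
    [Algebra.IsSeparable X.functionField Z.functionField] :
    ∃ U : X.Opens, Nonempty U ∧ ∀ (k : Type u) [Field k] (x : Spec (.of k) ⟶ X),
      Set.range x ⊆ U → IsReduced (pullback π x) := by
  obtain ⟨_, ⟨U, hU, rfl⟩, hxU, -⟩ := X.isBasis_affineOpens.exists_subset_of_mem_open
    (Set.mem_univ (genericPoint X)) isOpen_univ
  have : Nonempty U := ⟨_, hxU⟩
  have := nonempty_preimage π U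
  have hV := hU.preimage π
  have := functionField_isFractionRing_of_isAffineOpen X U hU
  have := functionField_isFractionRing_of_isAffineOpen Z (π ⁻¹ᵁ U) hV
  let _ : Algebra Γ(X, U) Γ(Z, π ⁻¹ᵁ U) := (π.app U).hom.toAlgebra
  let _ : Algebra Γ(X, U) Z.functionField :=
    ((algebraMap _ _).comp (algebraMap Γ(X, U) Γ(Z, π ⁻¹ᵁ U))).toAlgebra
  have : IsScalarTower Γ(X, U) Γ(Z, π ⁻¹ᵁ U) Z.functionField := .of_algebraMap_eq' rfl
  have : IsScalarTower Γ(X, U) X.functionField Z.functionField := .of_algebraMap_eq' <| by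
    rw [halg]
    exact congrArg CommRingCat.Hom.hom (germToFunctionField_functionFieldMap π U).symm
  have : Module.Finite Γ(X, U) Γ(Z, π ⁻¹ᵁ U) := IsFinite.finite_app (f := π) U hU
  obtain ⟨a, ha, hunr⟩ := Algebra.exists_formallyUnramified_away (A := Γ(X, U))
    (B := Γ(Z, π ⁻¹ᵁ U)) X.functionField Z.functionField
  let b : Γ(Z, π ⁻¹ᵁ U) := π.app U a
  let W := Z.basicOpen b
  have hWV : W ≤ π ⁻¹ᵁ U := Z.basicOpen_le b
  have hW : IsAffineOpen W := hV.basicOpen b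
  have hWU : π ⁻¹ᵁ X.basicOpen a = W := Scheme.preimage_basicOpen π a
  have hunr' : (π.appLE U W hWV).hom.FormallyUnramified := by
    let _ : Algebra Γ(Z, π ⁻¹ᵁ U) Γ(Z, W) := (Z.presheaf.map (homOfLE hWV).op).hom.toAlgebra
    let _ : Algebra Γ(X, U) Γ(Z, W) := (π.appLE U W hWV).hom.toAlgebra
    have : IsScalarTower Γ(X, U) Γ(Z, π ⁻¹ᵁ U) Γ(Z, W) := .of_algebraMap_eq' rfl
    have : IsLocalization.Away (algebraMap Γ(X, U) Γ(Z, π ⁻¹ᵁ U) a) Γ(Z, W) :=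
      hV.isLocalization_basicOpen b
    exact Algebra.FormallyUnramified.of_equiv ((IsLocalization.algEquiv
      (Submonoid.powers (algebraMap Γ(X, U) Γ(Z, π ⁻¹ᵁ U) a))
      (Localization.Away (algebraMap Γ(X, U) Γ(Z, π ⁻¹ᵁ U) a)) Γ(Z, W)).restrictScalars Γ(X, U))
  have hfu : FormallyUnramified (hW.fromSpec ≫ π) := by
    have : FormallyUnramified (Spec.map (π.appLE U W hWV)) :=
      (HasRingHomProperty.Spec_iff (P := @FormallyUnramified)).mpr hunr'
    rw [← IsAffineOpen.SpecMap_appLE_fromSpec π hU hW hWV]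
    have : IsOpenImmersion hU.fromSpec := IsAffineOpen.isOpenImmersion_fromSpec hU
    exact MorphismProperty.comp_mem @FormallyUnramified _ _ ‹_›
      (formallyUnramified_of_isOpenImmersion _)
  refine ⟨X.basicOpen a, ?_, fun k _ x hx ↦ ?_⟩
  · by_contra hemp
    refine ha ((basicOpen_eq_bot_iff a).mp ?_)
    ext y
    exact ⟨fun hy ↦ hemp ⟨y, hy⟩, fun hy ↦ hy.elim⟩
  · have hrange : Set.range (pullback.fst π x) ⊆ Set.range hW.fromSpec := by
      rw [Scheme.Pullback.range_fst, hW.range_fromSpec, ← hWU]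
      exact Set.preimage_mono hx
    have hp := isPullback_of_mono (IsPullback.of_hasPullback π x) hW.fromSpec
      (IsOpenImmersion.lift hW.fromSpec (pullback.fst π x) hrange)
      (IsOpenImmersion.lift_fac _ _ _)
    have : FormallyUnramified (pullback.snd π x) := MorphismProperty.of_isPullback hp hfu
    exact isReduced_of_formallyUnramified_of_field (pullback.snd π x)

namespace VeryThin.RationalPoint

variable {k : Type u} [Field k] {X : Scheme.{u}} {s : X ⟶ Spec (.of k)} (x : RationalPoint s)

lemma apply_eq_pt (y : Spec (.of k)) : x.1 y = x.pt :=
  congrArg x.1 (Subsingleton.elim (α := PrimeSpectrum k) _ _)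

lemma preimage_eq_top {U : X.Opens} (hx : x.pt ∈ U) : x.1 ⁻¹ᵁ U = ⊤ :=
  top_unique fun y _ ↦ (by rwa [← apply_eq_pt x y] at hx)

lemma specEval_surjective {U : X.Opens} (h : x.1 ⁻¹ᵁ U = ⊤) :
    Function.Surjective (specEval x.1 U h).hom := by
  have h1 : (x.1 ≫ s) ⁻¹ᵁ ⊤ = ⊤ := rfl
  have h2 : s.appLE ⊤ U le_top ≫ specEval x.1 U h = (Scheme.ΓSpecIso (.of k)).hom := by
    rw [← specEval_comp_appLE x.1 s ⊤ U le_top h1 h, specEval_congr x.2 ⊤ h1 rfl]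
    simp only [specEval, Scheme.Hom.appLE, Scheme.Hom.id_app]
    exact (congrArg (· ≫ _) ((Spec (.of k)).presheaf.map_id (op ⊤))).trans (Category.id_comp _)
  have h3 : Function.Surjective (s.appLE ⊤ U le_top ≫ specEval x.1 U h).hom := by
    rw [h2]
    exact (ConcreteCategory.bijective_of_isIso (Scheme.ΓSpecIso (.of k)).hom).2
  exact Function.Surjective.of_comp h3

/-- An extension of the evaluation homomorphism at `x` to the sections of `Y` over the preimage of
an affine neighbourhood of `x` is a rational point of `Y` above `x`. -/
lemma mem_range_map {Y : Scheme.{u}} (g : Y ⟶ X) [IsAffineHom g] {U : X.Opens}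
    (hU : IsAffineOpen U) (h : x.1 ⁻¹ᵁ U = ⊤) (ψ : Γ(Y, g ⁻¹ᵁ U) ⟶ .of k)
    (hψ : g.app U ≫ ψ = specEval x.1 U h) : x ∈ Set.range (RationalPoint.map s g) := by
  have hy : (Spec.map ψ ≫ (hU.preimage g).fromSpec) ≫ g = x.1 := by
    rw [Category.assoc, ← IsAffineOpen.SpecMap_appLE_fromSpec g hU (hU.preimage g) le_rfl,
      ← Scheme.Hom.app_eq_appLE, ← Spec.map_comp_assoc, hψ, SpecMap_specEval_fromSpec]
  exact ⟨⟨Spec.map ψ ≫ (hU.preimage g).fromSpec, by rw [← Category.assoc, hy, x.2]⟩, Subtype.ext hy⟩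

end VeryThin.RationalPoint

end AlgebraicGeometry

/-! ### Fibres with several points -/

namespace AlgebraicGeometry.VeryThin

namespace RationalPoint

variable {k : Type u} [Field k] {X : Scheme.{u}} {s : X ⟶ Spec (.of k)} (x : RationalPoint s)

/-- The primes of the points of `Z` above `x` lie over the kernel of evaluation at `x`. -/
lemma comap_primeIdealOf {Z : Scheme.{u}} (π : Z ⟶ X) [IsAffineHom π] {U : X.Opens}
    (hU : IsAffineOpen U) (h : x.1 ⁻¹ᵁ U = ⊤) (z : π ⁻¹ᵁ U) (hz : π z = x.pt) :
    ((hU.preimage π).primeIdealOf z).asIdeal.comap (π.app U).hom =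
      RingHom.ker (specEval x.1 U h).hom := by
  let q : Spec Γ(Z, π ⁻¹ᵁ U) := (hU.preimage π).primeIdealOf z
  let o : Spec (.of k) := IsLocalRing.closedPoint k
  have hq : hU.fromSpec (Spec.map (π.app U) q) = x.pt := by
    have h0 : Spec.map (π.app U) ≫ hU.fromSpec = (hU.preimage π).fromSpec ≫ π := by
      rw [Scheme.Hom.app_eq_appLE, IsAffineOpen.SpecMap_appLE_fromSpec π hU (hU.preimage π) le_rfl]
    exact (congrArg (fun m : Spec Γ(Z, π ⁻¹ᵁ U) ⟶ X ↦ m q) h0).trans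
      ((congrArg π ((hU.preimage π).fromSpec_primeIdealOf z)).trans hz)
  have ho : hU.fromSpec (Spec.map (specEval x.1 U h) o) = x.pt :=
    congrArg (fun m : Spec (.of k) ⟶ X ↦ m o) (SpecMap_specEval_fromSpec x.1 hU h)
  have h1 : Spec.map (π.app U) q = Spec.map (specEval x.1 U h) o :=
    have : IsOpenImmersion hU.fromSpec := IsAffineOpen.isOpenImmersion_fromSpec hU
    hU.fromSpec.isOpenEmbedding.injective (hq.trans ho.symm)
  have h2 : (IsLocalRing.closedPoint k).asIdeal = ⊥ :=
    IsLocalRing.maximalIdeal_eq_bot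
  have h3 := congrArg PrimeSpectrum.asIdeal h1
  change _ = (IsLocalRing.closedPoint k).asIdeal.comap (specEval x.1 U h).hom at h3
  rw [h2] at h3
  exact h3

/-- If the fibre of a Galois cover `Z ⟶ X` over the rational point `x` has two points, then `x`
lifts to a rational point of the quotient of `Z` by a proper subgroup `H` of the Galois group. Here
`H` is the decomposition group of one of the two points. The quotient enters only as a
factorization `Z ⟶ Y ⟶ X` for which the sections of `Y` are fixed by `H`. -/
theorem exists_subgroup_mem_range_map [CharZero k] {Z : Scheme.{u}} (π : Z ⟶ X) [IsCover s π]
    [IsIntegral X] [IsIntegral Z] [Surjective π] [Algebra X.functionField Z.functionField]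
    (halg : algebraMap X.functionField Z.functionField = (functionFieldMap π).hom)
    [IsGalois X.functionField Z.functionField] {z z' : Z} (hz : π z = x.pt) (hz' : π z' = x.pt)
    (hne : z ≠ z') :
    ∃ H : Subgroup Gal(Z.functionField/X.functionField), H ≠ ⊤ ∧
      ∀ (Y : Scheme.{u}) (f : Z ⟶ Y) (g : Y ⟶ X) (hfg : f ≫ g = π), IsAffineHom g →
        (∀ (U : X.Opens) [Nonempty U] [Nonempty (π ⁻¹ᵁ U)], IsAffineOpen U →
          ∀ c : Γ(Y, g ⁻¹ᵁ U), Z.germToFunctionField (π ⁻¹ᵁ U)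
            (f.appLE (g ⁻¹ᵁ U) (π ⁻¹ᵁ U) (by rw [← hfg, Scheme.Hom.comp_preimage]) c) ∈
              IntermediateField.fixedField H) →
        x ∈ Set.range (RationalPoint.map s g) := by
  have hX : IsNormalVariety s := IsCover.target π
  have hZ : IsNormalVariety (π ≫ s) := IsCover.source
  have : IsFinite π := IsCover.isFinite s
  obtain ⟨_, ⟨U, hU, rfl⟩, hxU, -⟩ := X.isBasis_affineOpens.exists_subset_of_mem_open
    (Set.mem_univ x.pt) isOpen_univ
  replace hU : IsAffineOpen U := hU
  have : Nonempty U := ⟨_, hxU⟩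
  have := nonempty_preimage π U
  have hV := hU.preimage π
  have hx := x.preimage_eq_top hxU
  have := hU.isIntegrallyClosed hX.isIntegrallyClosed_stalk
  have := hV.isIntegrallyClosed hZ.isIntegrallyClosed_stalk
  have := functionField_isFractionRing_of_isAffineOpen X U hU
  have := functionField_isFractionRing_of_isAffineOpen Z (π ⁻¹ᵁ U) hV
  have := finiteDimensional_functionField π halg
  let _ : Algebra Γ(X, U) Γ(Z, π ⁻¹ᵁ U) := (π.app U).hom.toAlgebra
  let _ : Algebra Γ(X, U) Z.functionField :=
    ((algebraMap _ _).comp (algebraMap Γ(X, U) Γ(Z, π ⁻¹ᵁ U))).toAlgebra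
  have : IsScalarTower Γ(X, U) Γ(Z, π ⁻¹ᵁ U) Z.functionField := .of_algebraMap_eq' rfl
  have : IsScalarTower Γ(X, U) X.functionField Z.functionField := .of_algebraMap_eq' <| by
    rw [halg]
    exact congrArg CommRingCat.Hom.hom (germToFunctionField_functionFieldMap π U).symm
  have : Module.Finite Γ(X, U) Γ(Z, π ⁻¹ᵁ U) := IsFinite.finite_app (f := π) U hU
  have : IsIntegralClosure Γ(Z, π ⁻¹ᵁ U) Γ(X, U) Z.functionField :=
    .of_isIntegrallyClosed _ _ _
  let φ := specEval x.1 U hx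
  have hφ : Function.Surjective φ.hom := x.specEval_surjective hx
  let P := RingHom.ker φ.hom
  have : P.IsMaximal := RingHom.ker_isMaximal_of_surjective φ.hom hφ
  have : CharZero (Γ(X, U) ⧸ P) :=
    charZero_of_injective_ringHom ((Ideal.Quotient.mk P).comp
      ((Scheme.ΓSpecIso (.of k)).inv ≫ s.appLE ⊤ U le_top).hom).injective
  have hzU : z ∈ π ⁻¹ᵁ U := by rwa [Scheme.Hom.mem_preimage, hz]
  have hzU' : z' ∈ π ⁻¹ᵁ U := by rwa [Scheme.Hom.mem_preimage, hz']
  let Q := hV.primeIdealOf ⟨z, hzU⟩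
  let Q' := hV.primeIdealOf ⟨z', hzU'⟩
  have hQ : Q.asIdeal.comap (π.app U).hom = P := x.comap_primeIdealOf π hU hx ⟨z, hzU⟩ hz
  have hQ' : Q'.asIdeal.comap (π.app U).hom = P := x.comap_primeIdealOf π hU hx ⟨z', hzU'⟩ hz'
  have hQQ' : Q.asIdeal ≠ Q'.asIdeal := by
    intro h
    apply hne
    have := congrArg hV.fromSpec (PrimeSpectrum.ext h)
    rwa [hV.fromSpec_primeIdealOf, hV.fromSpec_primeIdealOf] at this
  obtain ⟨H, hH, hfix⟩ := Ideal.exists_fixedField_sub_algebraMap_mem (A := Γ(X, U))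
    (B := Γ(Z, π ⁻¹ᵁ U)) (K := X.functionField) (L := Z.functionField) P Q.asIdeal Q'.asIdeal
    hQ hQ' hQQ'
  refine ⟨H, hH, fun Y f g hfg _ hY ↦ ?_⟩
  have hle : π ⁻¹ᵁ U ≤ f ⁻¹ᵁ g ⁻¹ᵁ U := by rw [← hfg, Scheme.Hom.comp_preimage]
  have hcomp : g.app U ≫ f.appLE (g ⁻¹ᵁ U) (π ⁻¹ᵁ U) hle = π.app U := by
    rw [Scheme.Hom.app_eq_appLE, Scheme.Hom.appLE_comp_appLE, Scheme.Hom.app_eq_appLE]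
    simp only [hfg]
  have hcomp' (a : Γ(X, U)) : (f.appLE (g ⁻¹ᵁ U) (π ⁻¹ᵁ U) hle).hom ((g.app U).hom a) =
    (π.app U).hom a := ConcreteCategory.congr_hom hcomp a
  obtain ⟨ψ, hψ⟩ := RingHom.exists_comp_eq_of_sub_mem φ.hom (g.app U).hom
    (f.appLE (g ⁻¹ᵁ U) (π ⁻¹ᵁ U) hle).hom Q.asIdeal
    (fun a ha ↦ by
      rw [hcomp'] at ha
      exact hQ.le ha)
    (fun c ↦ by
      obtain ⟨a, ha⟩ := hfix _ (hY U hU c)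
      refine ⟨a, ?_⟩
      rw [hcomp']
      exact ha)
  exact x.mem_range_map g hU hx (CommRingCat.ofHom ψ) (CommRingCat.hom_ext hψ)

end RationalPoint

/-- If the cover attached to an intermediate field `E` is trivial, then so is `E`. -/
theorem fixedField_eq_bot_of_isIso {k : Type u} [Field k] {X : Scheme.{u}} {s : X ⟶ Spec (.of k)}
    {Y Z : Scheme.{u}} (π : Z ⟶ X) [IsCover s π]
    [IsIntegral X] [IsIntegral Z] [Surjective π] [Algebra X.functionField Z.functionField]
    (halg : algebraMap X.functionField Z.functionField = (functionFieldMap π).hom)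
    (E : IntermediateField X.functionField Z.functionField)
    (f : Z ⟶ Y) (g : Y ⟶ X) (hfg : f ≫ g = π) [IsIso g]
    (hY : ∀ (U : X.Opens) [Nonempty U] [Nonempty (π ⁻¹ᵁ U)], IsAffineOpen U →
      ∀ b : Γ(Z, π ⁻¹ᵁ U), Z.germToFunctionField (π ⁻¹ᵁ U) b ∈ E → b ∈ Set.range
        (f.appLE (g ⁻¹ᵁ U) (π ⁻¹ᵁ U) (by rw [← hfg, Scheme.Hom.comp_preimage])).hom) :
    E = ⊥ := by
  have hZ : IsNormalVariety (π ≫ s) := IsCover.source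
  have : IsFinite π := IsCover.isFinite s
  obtain ⟨_, ⟨U, hU, rfl⟩, hxU, -⟩ := X.isBasis_affineOpens.exists_subset_of_mem_open
    (Set.mem_univ (genericPoint X)) isOpen_univ
  replace hU : IsAffineOpen U := hU
  have : Nonempty U := ⟨_, hxU⟩
  have := nonempty_preimage π U
  have hV := hU.preimage π
  have := hV.isIntegrallyClosed hZ.isIntegrallyClosed_stalk
  have := functionField_isFractionRing_of_isAffineOpen X U hU
  have := functionField_isFractionRing_of_isAffineOpen Z (π ⁻¹ᵁ U) hV
  have := finiteDimensional_functionField π halg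
  let _ : Algebra Γ(X, U) Γ(Z, π ⁻¹ᵁ U) := (π.app U).hom.toAlgebra
  let _ : Algebra Γ(X, U) Z.functionField :=
    ((algebraMap _ _).comp (algebraMap Γ(X, U) Γ(Z, π ⁻¹ᵁ U))).toAlgebra
  have : IsScalarTower Γ(X, U) Γ(Z, π ⁻¹ᵁ U) Z.functionField := .of_algebraMap_eq' rfl
  have : IsScalarTower Γ(X, U) X.functionField Z.functionField := .of_algebraMap_eq' <| by
    rw [halg]
    exact congrArg CommRingCat.Hom.hom (germToFunctionField_functionFieldMap π U).symm
  have : Module.Finite Γ(X, U) Γ(Z, π ⁻¹ᵁ U) := IsFinite.finite_app (f := π) U hU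
  have : IsIntegralClosure Γ(Z, π ⁻¹ᵁ U) Γ(X, U) Z.functionField :=
    .of_isIntegrallyClosed _ _ _
  have hle : π ⁻¹ᵁ U ≤ f ⁻¹ᵁ g ⁻¹ᵁ U := by rw [← hfg, Scheme.Hom.comp_preimage]
  have hcomp : g.app U ≫ f.appLE (g ⁻¹ᵁ U) (π ⁻¹ᵁ U) hle = π.app U := by
    rw [Scheme.Hom.app_eq_appLE, Scheme.Hom.appLE_comp_appLE, Scheme.Hom.app_eq_appLE]
    simp only [hfg]
  refine le_bot_iff.mp fun e he ↦ ?_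
  have halgA : Algebra.IsAlgebraic Γ(X, U) Z.functionField :=
    (IsFractionRing.comap_isAlgebraic_iff (K := X.functionField)).mpr inferInstance
  -- A multiple `a • e` is integral over `Γ(X, U)`, so it is a section of `Z` which lies in `E`.
  obtain ⟨a, ha, hint⟩ := (halgA.isAlgebraic e).exists_integral_multiple
  obtain ⟨b, hb⟩ := IsIntegralClosure.isIntegral_iff (A := Γ(Z, π ⁻¹ᵁ U)) |>.mp hint
  have hbE : Z.germToFunctionField (π ⁻¹ᵁ U) b ∈ E := by
    change algebraMap Γ(Z, π ⁻¹ᵁ U) Z.functionField b ∈ E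
    rw [hb, ← algebraMap_smul X.functionField]
    exact E.smul_mem he
  obtain ⟨c, rfl⟩ := hY U hU b hbE
  obtain ⟨a', rfl⟩ := (ConcreteCategory.bijective_of_isIso (g.app U)).2 c
  have h1 : algebraMap X.functionField Z.functionField (algebraMap Γ(X, U) X.functionField a') =
      a • e := by
    rw [← hb, ← IsScalarTower.algebraMap_apply, IsScalarTower.algebraMap_apply Γ(X, U)
      Γ(Z, π ⁻¹ᵁ U) Z.functionField]
    congr 1
    exact (ConcreteCategory.congr_hom hcomp a').symm
  have ha0 : algebraMap Γ(X, U) X.functionField a ≠ 0 := by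
    simpa using ha
  rw [IntermediateField.mem_bot]
  refine ⟨algebraMap Γ(X, U) X.functionField a' / algebraMap Γ(X, U) X.functionField a, ?_⟩
  rw [map_div₀, h1, Algebra.smul_def, ← IsScalarTower.algebraMap_apply]
  refine mul_div_cancel_left₀ _ ?_
  rw [IsScalarTower.algebraMap_apply Γ(X, U) X.functionField Z.functionField]
  simpa using ha

end AlgebraicGeometry.VeryThin

/-! ### Integral fibres -/

namespace AlgebraicGeometry.VeryThin

/-- A reduced fibre consisting of a single point is integral. -/
theorem RationalPoint.isIntegral_fibre {k : Type u} [Field k] {X Z : Scheme.{u}}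
    {s : X ⟶ Spec (.of k)} [IsSeparated s] (x : RationalPoint s) (π : Z ⟶ X) [Surjective π]
    [IsReduced (pullback π x.1)] (h : ∀ z z' : Z, π z = x.pt → π z' = x.pt → z = z') :
    IsIntegral (x.fibre π) := by
  have : IsClosedImmersion (x.1 ≫ s) := by rw [x.2]; infer_instance
  have : IsClosedImmersion x.1 := .of_comp x.1 s
  have hpt (w : ↥(pullback π x.1)) : π (pullback.fst π x.1 w) = x.pt := by
    rw [← Scheme.Hom.comp_apply, pullback.condition, Scheme.Hom.comp_apply, x.apply_eq_pt]
  have : Subsingleton ↥(pullback π x.1) := ⟨fun w w' ↦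
    (pullback.fst π x.1).isEmbedding.injective (h _ _ (hpt w) (hpt w'))⟩
  have : Nonempty ↥(pullback π x.1) :=
    ⟨((pullback.snd π x.1).surjective (IsLocalRing.closedPoint k)).choose⟩
  have : PreirreducibleSpace ↥(pullback π x.1) := ⟨Set.subsingleton_univ.isPreirreducible⟩
  have : IrreducibleSpace ↥(pullback π x.1) := ⟨‹_›⟩
  exact isIntegral_of_irreducibleSpace_of_isReduced (pullback π x.1)

end AlgebraicGeometry.VeryThin

theorem mainTheorem12 {k : Type u} [Field k] [CharZero k]
    {X Z : Scheme.{u}} (s : X ⟶ Spec (.of k))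
    (hX : IsNormalVariety s)
    (S : Set (RationalPoint s))
    (π : Z ⟶ X)
    (hram : IsRamifiedCover s π)
    (hgal : IsGaloisCover s π)
    (het : HasNoNontrivialEtaleSubcovers s π)
    (hS : ¬ IsVeryThin s S) :
    ∃ T : Set (RationalPoint s), T ⊆ S ∧
      Dense (RationalPoint.pt '' T) ∧
      ∀ x ∈ T, AlgebraicGeometry.IsIntegral (x.fibre π) := by
  have hcov : IsCover s π := hgal.toIsCover
  have hZ : IsNormalVariety (π ≫ s) := IsCover.source
  have := hX.isIntegral
  have := hZ.isIntegral
  have := hX.isSeparated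
  have : IsFinite π := IsCover.isFinite s
  have : Surjective π := IsCover.surjective s
  let _ : Algebra X.functionField Z.functionField := (functionFieldMap π).hom.toAlgebra
  have halg : algebraMap X.functionField Z.functionField = (functionFieldMap π).hom := rfl
  have : IsGalois X.functionField Z.functionField := hgal.isGalois
  have := finiteDimensional_functionField π halg
  choose Y f g hfg hf hg hfix using
    fun H : Subgroup Gal(Z.functionField/X.functionField) ↦
      exists_intermediate_cover s π
        (CommRingCat.ofHom (algebraMap X.functionField (IntermediateField.fixedField H)))
        (CommRingCat.ofHom (algebraMap (IntermediateField.fixedField H) Z.functionField)) rfl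
  have hmem (H : Subgroup Gal(Z.functionField/X.functionField)) (a : Z.functionField) :
      a ∈ Set.range (CommRingCat.ofHom
        (algebraMap (IntermediateField.fixedField H) Z.functionField)).hom ↔
      a ∈ IntermediateField.fixedField H :=
    Set.ext_iff.mp Subtype.range_coe a
  have hramified (H : Subgroup Gal(Z.functionField/X.functionField)) (hH : H ≠ ⊤) :
      IsRamifiedCover s (g H) := by
    refine { toIsCover := hg H, not_unramified := fun _ ↦ hH ?_ }
    have := hg H
    have := het (Y H) (f H) (g H) (hfg H) (hf H) (hg H) (IsCover.etale_of_formallyUnramified s _)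
    have hbot := fixedField_eq_bot_of_isIso (s := s) π halg (IntermediateField.fixedField H)
      (f H) (g H) (hfg H) fun U _ _ hU b hb ↦ (hfix H U hU b).mp ((hmem H _).mpr hb)
    rw [← IntermediateField.fixingSubgroup_fixedField H, hbot,
      IntermediateField.fixingSubgroup_bot]
  let e := Finite.equivFin {H : Subgroup Gal(Z.functionField/X.functionField) // H ≠ ⊤}
  let S' : Set (RationalPoint s) :=
    S \ ⋃ i, Set.range (RationalPoint.map s (g (e.symm i).1))
  have hS' : Dense (RationalPoint.pt '' S') := by
    by_contra hS'
    exact hS ⟨_, fun i ↦ Y (e.symm i).1, fun i ↦ g (e.symm i).1,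
      fun i ↦ hramified _ (e.symm i).2, hS'⟩
  obtain ⟨U, hU, hred⟩ := exists_isReduced_pullback π halg
  refine ⟨{x ∈ S' | x.pt ∈ U}, fun x hx ↦ hx.1.1, ?_, fun x hx ↦ ?_⟩
  · have himage : RationalPoint.pt '' {x ∈ S' | x.pt ∈ U} = RationalPoint.pt '' S' ∩ U :=
      Set.image_inter_preimage _ _ _
    rw [himage]
    exact hS'.inter_of_isOpen_right (U.2.dense (Set.nonempty_coe_sort.mp hU)) U.2
  · have : AlgebraicGeometry.IsReduced (pullback π x.1) := hred k x.1 <| by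
      rintro _ ⟨y, rfl⟩
      rw [x.apply_eq_pt]
      exact hx.2
    refine x.isIntegral_fibre π fun z z' hz hz' ↦ ?_
    by_contra hne
    obtain ⟨H, hH, hrange⟩ := x.exists_subgroup_mem_range_map π halg hz hz' hne
    refine hx.1.2 (Set.mem_iUnion.mpr ⟨e ⟨H, hH⟩, ?_⟩)
    rw [e.symm_apply_apply]
    have : IsFinite (g H) := (hg H).isFinite
    exact hrange (Y H) (f H) (g H) (hfg H) inferInstance fun U _ _ hU c ↦
      (hmem H _).mp ((hfix H U hU _).mpr ⟨c, rfl⟩)
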